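/- Let $n\ge 1$ be an integer, let $0<\alpha<n$, and let $p$ be a real number with $p<\frac{n+\alpha}{n-\alpha}$. Then the integral equation $$u(x)=\int_{\mathbb{R}^n}\frac{1}{|x-y|^{n-\alpha}}\,u(y)^p\,dy,\qquad x\in\mathbb{R}^n,$$ has no regular positive solution. That is, there is no Lebesgue measurable function $u:\mathbb{R}^n\to(0,\infty)$, finite at every point, that satisfies this equation for every $x\in\mathbb{R}^n$. -/

import Mathlib

open MeasureTheory
open scoped ENNReal

/-- `u` is a positive, possibly singular (value `∞` allowed), solution of
`u(x) = ∫_{ℝⁿ} |x - y|^{α - n} u(y)^p dy`. The integral of the nonnegative integrand is the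
Lebesgue integral with values in `[0, ∞]`, and the equation holds at every point `x`.
Almost everywhere measurability with respect to `volume` is Lebesgue measurability of `u`. -/
structure IsPositiveSolution (n : ℕ) (α p : ℝ) (u : EuclideanSpace ℝ (Fin n) → ℝ≥0∞) : Prop where
  aemeasurable : AEMeasurable u volume
  pos : ∀ x, 0 < u x
  eq : ∀ x, u x = ∫⁻ y, ‖x - y‖ₑ ^ (α - n) * u y ^ p

/-- `u` is regular: it is finite at every point. -/
def IsEverywhereFinite {n : ℕ} (u : EuclideanSpace ℝ (Fin n) → ℝ≥0∞) : Prop :=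
  ∀ x, u x ≠ ∞

/-!
Suppose `u` is positive, finite everywhere and `u = |·|^(α - n) ∗ u ^ p`. Fatou's lemma makes `u`
lower semicontinuous; that is all the regularity used below, and no local integrability of higher
powers of `u` is assumed.

For `p < 1` the scaling `u ↦ R ^ (α / (p - 1)) u(R ·)` produces solutions with arbitrarily small
value at the origin, while the equation on the unit ball forces a universal lower bound for that
value (`IsPositiveSolution.not_isEverywhereFinite_of_lt_one`).

For `1 ≤ p` the method of moving spheres applies. Folding the exterior of a ball into the ball by
inversion expresses both `u` and its Kelvin transform as integrals over the ball
(`eq_setLIntegral_ball`, `kelvin_eq_setLIntegral_ball`). Because the reflected kernel is smaller than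
the kernel, the excess of `u` over its Kelvin transform is bounded by an integral over the set where
there is an excess, so if `u` is bounded and that set is small, it is empty
(`exists_pos_leKelvin_of_volume_lt`). This starts the process at radius zero. Subcriticality makes
every comparison strict (`lt_kelvin`), so the sphere can always be enlarged, and `u` lies below its
Kelvin transform in every sphere inside a ball on which `u` is bounded (`leKelvin_of_bddOn_ball`).

Any two points are exchanged by spheres with centres on their line, so this comparison is a Harnack
inequality (`apply_le_of_bddOn_ball`). It is used twice. First, it bounds `u` near the closed
set of points where `u` is not locally bounded by its values on that set; by Baire's theorem `u` is
bounded on a relatively open part of the set, which must therefore be empty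
(`singularSet_eq_empty`). Then `u` is bounded on every ball, and letting the centre go to infinity
gives `u z ≤ u y` for all `y`, `z` (`apply_le_apply`). Hence `u` is constant, but the kernel is not
integrable at infinity (`not_forall_eq`).
-/

open Set Filter Topology Metric
open EuclideanGeometry (inversion)

/-! ### The Riesz kernel -/

theorem ENNReal.rpow_le_rpow_of_exponent_nonpos {a b : ℝ≥0∞} {z : ℝ} (hab : a ≤ b) (hz : z ≤ 0) :
    b ^ z ≤ a ^ z := by
  rw [← neg_neg z, ENNReal.rpow_neg b, ENNReal.rpow_neg a]
  exact ENNReal.inv_le_inv.2 (ENNReal.rpow_le_rpow hab (by linarith))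

theorem ENNReal.rpow_lt_rpow_of_exponent_neg {a b : ℝ≥0∞} {z : ℝ} (hab : a < b) (hz : z < 0) :
    b ^ z < a ^ z := by
  rw [← neg_neg z, ENNReal.rpow_neg b, ENNReal.rpow_neg a]
  exact ENNReal.inv_lt_inv.2 (ENNReal.rpow_lt_rpow hab (by linarith))

section Kernel

variable {n : ℕ} {α : ℝ}

theorem setLIntegral_ball_enorm_rpow_ne_top (hα : 0 < α) (hαn : α < n) :
    ∫⁻ z in ball (0 : EuclideanSpace ℝ (Fin n)) 1, ‖z‖ₑ ^ (α - n) ≠ ∞ := by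
  have hn : 1 ≤ n := by
    by_contra h
    have : n = 0 := by omega
    subst this
    simp at hαn
    linarith
  have h := integrableOn_ball_of_norm_le_rpow (E := EuclideanSpace ℝ (Fin n)) (μ := volume)
    (f := fun z => ‖z‖ ^ (α - n)) (C := 1) (α := n - α) (r := 1) (by simpa using hn)
    (by simp; linarith)
    (Eventually.of_forall fun x => by
      rw [Real.norm_of_nonneg (by positivity), neg_sub, one_mul])
    (measurable_norm.pow_const _).aestronglyMeasurable
  convert h.2.ne using 1
  refine lintegral_congr_ae ?_
  have : Nontrivial (EuclideanSpace ℝ (Fin n)) := by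
    have : Nonempty (Fin n) := ⟨⟨0, hn⟩⟩
    infer_instance
  refine ae_restrict_of_ae ?_
  filter_upwards [compl_mem_ae_iff.2 (measure_singleton (0 : EuclideanSpace ℝ (Fin n)))] with z hz
  have hz' : 0 < ‖z‖ := norm_pos_iff.2 hz
  rw [Real.enorm_of_nonneg (by positivity), ← ENNReal.ofReal_rpow_of_pos hz', ofReal_norm]

/-- The integral of the kernel over a set splits into a part near the singularity, translated to
the origin, and a part where the kernel is at most `1`. -/
theorem exists_setLIntegral_kernel_le (hαn : α < n) (A : Set (EuclideanSpace ℝ (Fin n)))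
    (y : EuclideanSpace ℝ (Fin n)) :
    ∃ A' : Set (EuclideanSpace ℝ (Fin n)), volume A' = volume A ∧
      ∫⁻ z in A, ‖y - z‖ₑ ^ (α - n) ≤ (∫⁻ z in A' ∩ ball 0 1, ‖z‖ₑ ^ (α - n)) + volume A := by
  have hmp : MeasurePreserving (fun z : EuclideanSpace ℝ (Fin n) => y - z) volume volume :=
    Measure.measurePreserving_sub_left volume y
  have hemb : MeasurableEmbedding (fun z : EuclideanSpace ℝ (Fin n) => y - z) :=
    (MeasurableEquiv.subLeft y).measurableEmbedding
  have hinv : (fun z => y - z) ⁻¹' ((fun z => y - z) ⁻¹' A) = A := by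
    ext z; simp
  have hA' : volume ((fun z => y - z) ⁻¹' A) = volume A := hmp.measure_preimage_emb hemb A
  refine ⟨(fun z => y - z) ⁻¹' A, hA', ?_⟩
  rw [← hA']
  set A' := (fun z => y - z) ⁻¹' A
  rw [← hinv, hmp.setLIntegral_comp_preimage_emb hemb (fun z => ‖z‖ₑ ^ (α - n))]
  have hsplit : ∀ z : EuclideanSpace ℝ (Fin n), ‖z‖ₑ ^ (α - n) ≤
      (ball 0 1).indicator (fun z => ‖z‖ₑ ^ (α - n)) z + 1 := by
    intro z
    by_cases hz : z ∈ ball (0 : EuclideanSpace ℝ (Fin n)) 1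
    · simp [hz]
    · have h1 : (1 : ℝ≥0∞) ≤ ‖z‖ₑ := by
        rw [← ofReal_norm, ENNReal.one_le_ofReal]
        simpa using hz
      have := ENNReal.rpow_le_rpow_of_exponent_nonpos h1 (by linarith : α - n ≤ 0)
      rw [ENNReal.one_rpow] at this
      exact this.trans le_add_self
  calc ∫⁻ z in A', ‖z‖ₑ ^ (α - n)
      ≤ ∫⁻ z in A', ((ball 0 1).indicator (fun z => ‖z‖ₑ ^ (α - n)) z + 1) := lintegral_mono hsplit
    _ = (∫⁻ z in A' ∩ ball 0 1, ‖z‖ₑ ^ (α - n)) + volume A' := by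
        rw [lintegral_add_right _ measurable_const, lintegral_indicator measurableSet_ball,
          Measure.restrict_restrict measurableSet_ball, inter_comm]
        simp

/-- The Riesz kernel is integrable, uniformly in its singularity, over sets of small measure. -/
theorem exists_pos_setLIntegral_kernel_le (hα : 0 < α) (hαn : α < n) {ε : ℝ≥0∞} (hε : ε ≠ 0) :
    ∃ δ > 0, ∀ A : Set (EuclideanSpace ℝ (Fin n)), volume A < δ → ∀ y,
      ∫⁻ z in A, ‖y - z‖ₑ ^ (α - n) ≤ ε := by
  obtain ⟨δ, hδ, H⟩ := exists_pos_setLIntegral_lt_of_measure_lt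
    (setLIntegral_ball_enorm_rpow_ne_top hα hαn) (ENNReal.half_pos hε).ne'
  refine ⟨min δ (ε / 2), lt_min hδ (ENNReal.half_pos hε), fun A hA y => ?_⟩
  obtain ⟨A', hA', h⟩ := exists_setLIntegral_kernel_le hαn A y
  refine h.trans ?_
  rw [← ENNReal.add_halves ε]
  gcongr
  · rw [← Measure.restrict_restrict₀' measurableSet_ball.nullMeasurableSet]
    refine (H A' ((Measure.restrict_apply_le _ _).trans_lt ?_)).le
    rw [hA']
    exact hA.trans_le (min_le_left _ _)
  · exact hA.le.trans (min_le_right _ _)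

theorem lowerSemicontinuous_lintegral_kernel (hαn : α < n) {f : EuclideanSpace ℝ (Fin n) → ℝ≥0∞}
    (hf : AEMeasurable f) :
    LowerSemicontinuous fun x => ∫⁻ y, ‖x - y‖ₑ ^ (α - n) * f y := by
  rw [lowerSemicontinuous_iff_le_liminf]
  intro x
  refine le_trans (lintegral_mono fun y => ?_)
    (lintegral_liminf_le' (u := 𝓝 x) fun x => by fun_prop)
  have hne : ‖x - y‖ₑ ^ (α - n) ≠ 0 ∨ f y ≠ ∞ := by
    simp [ENNReal.rpow_eq_zero_iff, hαn.le]
  refine (ENNReal.Tendsto.mul_const (Continuous.tendsto ?_ x) hne).liminf_eq.ge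
  exact ENNReal.continuous_rpow_const.comp (by fun_prop)

theorem lintegral_comp_smul_eq {R : ℝ} (hR : 0 < R) (f : EuclideanSpace ℝ (Fin n) → ℝ≥0∞) :
    ∫⁻ y, f y = ENNReal.ofReal R ^ (n : ℝ) * ∫⁻ z, f (R • z) := by
  have h := Measure.map_addHaar_smul (volume : Measure (EuclideanSpace ℝ (Fin n))) hR.ne'
  have hemb : MeasurableEmbedding fun z : EuclideanSpace ℝ (Fin n) => R • z :=
    (Homeomorph.smulOfNeZero R hR.ne').measurableEmbedding
  rw [← hemb.lintegral_map, h, lintegral_smul_measure, smul_eq_mul, ← mul_assoc,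
    ENNReal.ofReal_rpow_of_pos hR, ← ENNReal.ofReal_mul (by positivity), finrank_euclideanSpace,
    Fintype.card_fin, Real.rpow_natCast, abs_of_pos (by positivity), mul_inv_cancel₀ (by positivity),
    ENNReal.ofReal_one, one_mul]

/-- Averaging the kernel over the unit ball does not change its order of magnitude. -/
theorem exists_setLIntegral_ball_kernel_le (hα : 0 < α) (hαn : α < n) :
    ∃ K : ℝ≥0∞, K ≠ ∞ ∧ ∀ y : EuclideanSpace ℝ (Fin n),
      ∫⁻ x in ball (0 : EuclideanSpace ℝ (Fin n)) 1, ‖x - y‖ₑ ^ (α - n) ≤ K * ‖y‖ₑ ^ (α - n) := by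
  set I := ∫⁻ z in ball (0 : EuclideanSpace ℝ (Fin n)) 1, ‖z‖ₑ ^ (α - n)
  set V := volume (ball (0 : EuclideanSpace ℝ (Fin n)) 1)
  have hI : I ≠ ∞ := setLIntegral_ball_enorm_rpow_ne_top hα hαn
  have hV : V ≠ ∞ := measure_ball_lt_top.ne
  have hs : α - n ≤ 0 := by linarith
  have h2 : (2⁻¹ : ℝ≥0∞) ^ (α - n) ≠ ∞ := ENNReal.rpow_ne_top_of_ne_zero (by simp) (by simp)
  refine ⟨(2⁻¹ : ℝ≥0∞) ^ (α - n) * (I + V), by finiteness, fun y => ?_⟩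
  have hhalf : (2⁻¹ : ℝ≥0∞) ^ (α - n) * ‖y‖ₑ ^ (α - n) = (2⁻¹ * ‖y‖ₑ) ^ (α - n) :=
    (ENNReal.mul_rpow_of_ne_top (by simp) (by finiteness) _).symm
  rw [mul_right_comm, hhalf]
  by_cases hy : ‖y‖ < 2
  · -- The singularity is near the ball: compare with the kernel centred in the ball.
    have h1 : (1 : ℝ≥0∞) ≤ (2⁻¹ * ‖y‖ₑ) ^ (α - n) := by
      rw [← ENNReal.one_rpow (α - n)]
      refine ENNReal.rpow_le_rpow_of_exponent_nonpos ?_ hs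
      rw [← ofReal_norm, mul_comm, ← div_eq_mul_inv, ENNReal.div_le_iff (by simp) (by simp),
        one_mul]
      exact ENNReal.ofReal_le_of_le_toReal (by simpa using hy.le)
    obtain ⟨A', -, h⟩ := exists_setLIntegral_kernel_le hαn (ball 0 1) y
    calc _ = ∫⁻ x in ball (0 : EuclideanSpace ℝ (Fin n)) 1, ‖y - x‖ₑ ^ (α - n) := by
          simp_rw [enorm_sub_rev]
      _ ≤ 1 * (I + V) := by
          rw [one_mul]
          refine h.trans (by gcongr; exact lintegral_mono_set inter_subset_right)
      _ ≤ _ := by gcongr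
  · have hle : ∀ x ∈ ball (0 : EuclideanSpace ℝ (Fin n)) 1,
        ‖x - y‖ₑ ^ (α - n) ≤ (2⁻¹ * ‖y‖ₑ) ^ (α - n) := by
      intro x hx
      refine ENNReal.rpow_le_rpow_of_exponent_nonpos ?_ hs
      rw [← ofReal_norm, ← ofReal_norm, mul_comm, ← div_eq_mul_inv,
        ENNReal.div_le_iff (by simp) (by simp),
        show ENNReal.ofReal ‖x - y‖ * 2 = ENNReal.ofReal (‖x - y‖ * 2) by
          rw [ENNReal.ofReal_mul (norm_nonneg _)]; simp]
      apply ENNReal.ofReal_le_ofReal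
      have := norm_sub_norm_le y x
      rw [norm_sub_rev] at this
      simp only [mem_ball, dist_zero_right] at hx
      linarith
    calc _ ≤ ∫⁻ x in ball (0 : EuclideanSpace ℝ (Fin n)) 1, (2⁻¹ * ‖y‖ₑ) ^ (α - n) :=
          setLIntegral_mono measurable_const hle
      _ = (2⁻¹ * ‖y‖ₑ) ^ (α - n) * V := by simp [V]
      _ ≤ _ := by gcongr; exact le_add_self

end Kernel

/-! ### Elementary properties and symmetries of solutions -/

namespace IsPositiveSolution

variable {n : ℕ} {α p : ℝ} {u : EuclideanSpace ℝ (Fin n) → ℝ≥0∞}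

theorem lowerSemicontinuous (hu : IsPositiveSolution n α p u) (hαn : α < n) :
    LowerSemicontinuous u := by
  rw [funext hu.eq]
  exact lowerSemicontinuous_lintegral_kernel hαn (hu.aemeasurable.pow_const p)

theorem measurable (hu : IsPositiveSolution n α p u) (hαn : α < n) : Measurable u :=
  (hu.lowerSemicontinuous hαn).measurable

theorem rpow_ne_zero (hu : IsPositiveSolution n α p u) (hfin : IsEverywhereFinite u)
    (x : EuclideanSpace ℝ (Fin n)) (s : ℝ) : u x ^ s ≠ 0 :=
  (ENNReal.rpow_pos (hu.pos x) (hfin x)).ne'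

theorem rpow_ne_top (hu : IsPositiveSolution n α p u) (hfin : IsEverywhereFinite u)
    (x : EuclideanSpace ℝ (Fin n)) (s : ℝ) : u x ^ s ≠ ∞ :=
  ENNReal.rpow_ne_top_of_ne_zero (hu.pos x).ne' (hfin x)

theorem comp_add (hu : IsPositiveSolution n α p u) (hαn : α < n)
    (c : EuclideanSpace ℝ (Fin n)) : IsPositiveSolution n α p fun x => u (x + c) where
  aemeasurable := ((hu.measurable hαn).comp (measurable_add_const c)).aemeasurable
  pos x := hu.pos _
  eq x := by
    rw [hu.eq, ← lintegral_add_right_eq_self _ c]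
    simp

/-- The scaling `u ↦ R ^ (α / (p - 1)) u(R ·)` preserves solutions. -/
theorem scale (hu : IsPositiveSolution n α p u) (hαn : α < n) (hp : p ≠ 1) {R : ℝ} (hR : 0 < R) :
    IsPositiveSolution n α p fun x => ENNReal.ofReal R ^ (α / (p - 1)) * u (R • x) where
  aemeasurable := (((hu.measurable hαn).comp (measurable_const_smul R)).const_mul _).aemeasurable
  pos x := ENNReal.mul_pos (ENNReal.rpow_pos (by simpa using hR) ENNReal.ofReal_ne_top).ne'
    (hu.pos _).ne'
  eq x := by
    have h0 : ENNReal.ofReal R ≠ 0 := by simpa using hR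
    have ht : ENNReal.ofReal R ≠ ∞ := ENNReal.ofReal_ne_top
    have hp' : p - 1 ≠ 0 := sub_ne_zero.2 hp
    set ρ := ENNReal.ofReal R
    have hc : ρ ^ (α / (p - 1)) ≠ ∞ := ENNReal.rpow_ne_top_of_ne_zero h0 ht
    have hn : ρ ^ (n : ℝ) ≠ ∞ := ENNReal.rpow_ne_top_of_ne_zero h0 ht
    rw [hu.eq, lintegral_comp_smul_eq hR, ← mul_assoc,
      ← lintegral_const_mul' _ _ (ENNReal.mul_ne_top hc hn)]
    refine lintegral_congr fun z => ?_
    have hc0 : ρ ^ (α / (p - 1)) ≠ 0 := (ENNReal.rpow_pos (pos_iff_ne_zero.2 h0) ht).ne'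
    rw [← smul_sub, enorm_smul, Real.enorm_of_nonneg hR.le,
      ENNReal.mul_rpow_of_ne_top ht (by finiteness),
      ENNReal.mul_rpow_of_ne_zero hc0 (hu.pos _).ne', ← ENNReal.rpow_mul]
    -- The powers of `R` match: `γ + n + (α - n) = γ p` for `γ = α / (p - 1)`.
    have hexp : ρ ^ (α / (p - 1)) * ρ ^ (n : ℝ) * ρ ^ (α - n) = ρ ^ (α / (p - 1) * p) := by
      rw [← ENNReal.rpow_add _ _ h0 ht, ← ENNReal.rpow_add _ _ h0 ht]
      congr 1
      field_simp
      ring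
    rw [← hexp]
    ring

end IsPositiveSolution

/-! ### Exponents below one -/

namespace IsPositiveSolution

variable {n : ℕ} {α p : ℝ} {u : EuclideanSpace ℝ (Fin n) → ℝ≥0∞}

theorem setLIntegral_ball_rpow_le (hu : IsPositiveSolution n α p u) (hαn : α < n) :
    ∫⁻ y in ball (0 : EuclideanSpace ℝ (Fin n)) 1, u y ^ p ≤ u 0 := by
  rw [hu.eq 0]
  refine le_trans (setLIntegral_mono' measurableSet_ball fun y hy => ?_)
    (setLIntegral_le_lintegral (ball 0 1) _)
  have h1 : ‖(0 : EuclideanSpace ℝ (Fin n)) - y‖ₑ ≤ 1 := by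
    rw [← ofReal_norm, ENNReal.ofReal_le_one]
    simpa using (mem_ball_zero_iff.1 hy).le
  have := ENNReal.rpow_le_rpow_of_exponent_nonpos h1 (by linarith : α - n ≤ 0)
  rw [ENNReal.one_rpow] at this
  exact le_mul_of_one_le_left' this

/-- For a negative exponent, `u` is at most `1` or at least `1` on a substantial part of the unit
ball; the first bounds `∫ u ^ p` from below and the second the mean of `u`, and both are controlled
by `u 0`. -/
theorem exists_le_apply_zero_of_neg (hα : 0 < α) (hαn : α < n) (hp : p < 0) :
    ∃ c : ℝ≥0∞, c ≠ 0 ∧ ∀ u : EuclideanSpace ℝ (Fin n) → ℝ≥0∞, IsPositiveSolution n α p u →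
      c ≤ u 0 := by
  obtain ⟨K, hK, hker⟩ := exists_setLIntegral_ball_kernel_le hα hαn
  set B := ball (0 : EuclideanSpace ℝ (Fin n)) 1
  have hV0 : volume B ≠ 0 := (measure_ball_pos volume 0 one_pos).ne'
  refine ⟨volume B / (K + 1), by simp [ENNReal.div_eq_zero_iff, hV0, hK], fun u hu => ?_⟩
  have hmeas := hu.measurable hαn
  have hmean : ∫⁻ x in B, u x ≤ K * u 0 := by
    calc ∫⁻ x in B, u x = ∫⁻ x in B, ∫⁻ y, ‖x - y‖ₑ ^ (α - n) * u y ^ p :=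
          lintegral_congr fun x => hu.eq x
      _ = ∫⁻ y, ∫⁻ x in B, ‖x - y‖ₑ ^ (α - n) * u y ^ p := by
          refine lintegral_lintegral_swap (Measurable.aemeasurable ?_)
          fun_prop
      _ = ∫⁻ y, (∫⁻ x in B, ‖x - y‖ₑ ^ (α - n)) * u y ^ p := by
          refine lintegral_congr fun y => lintegral_mul_const _ (by fun_prop)
      _ ≤ ∫⁻ y, K * (‖0 - y‖ₑ ^ (α - n) * u y ^ p) := by
          refine lintegral_mono fun y => ?_
          rw [← mul_assoc, zero_sub, enorm_neg]
          gcongr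
          exact hker y
      _ = K * u 0 := by rw [lintegral_const_mul' _ _ hK, ← hu.eq 0]
  have hcover : ∀ x, (1 : ℝ≥0∞) ≤ u x + u x ^ p := by
    intro x
    rcases le_total 1 (u x) with h | h
    · exact h.trans le_self_add
    · have := ENNReal.rpow_le_rpow_of_exponent_nonpos h hp.le
      rw [ENNReal.one_rpow] at this
      exact this.trans le_add_self
  apply ENNReal.div_le_of_le_mul
  calc volume B = ∫⁻ x in B, 1 := by simp
    _ ≤ ∫⁻ x in B, (u x + u x ^ p) := lintegral_mono hcover
    _ = (∫⁻ x in B, u x) + ∫⁻ x in B, u x ^ p := lintegral_add_left hmeas _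
    _ ≤ K * u 0 + u 0 := add_le_add hmean (hu.setLIntegral_ball_rpow_le hαn)
    _ = u 0 * (K + 1) := by ring

/-- For an exponent in `[0, 1)`, the infimum `m` of `u` over the unit ball satisfies
`m ≥ C m ^ p`. -/
theorem exists_le_apply_zero_of_nonneg (hαn : α < n) (hp : 0 ≤ p) (hp1 : p < 1) :
    ∃ c : ℝ≥0∞, c ≠ 0 ∧ ∀ u : EuclideanSpace ℝ (Fin n) → ℝ≥0∞, IsPositiveSolution n α p u →
      IsEverywhereFinite u → c ≤ u 0 := by
  set B := ball (0 : EuclideanSpace ℝ (Fin n)) 1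
  have hV0 : volume B ≠ 0 := (measure_ball_pos volume 0 one_pos).ne'
  have h20 : (2 : ℝ≥0∞) ^ (α - n) ≠ 0 := (ENNReal.rpow_pos (by simp) (by simp)).ne'
  refine ⟨((2 : ℝ≥0∞) ^ (α - n) * volume B) ^ (1 / (1 - p)), ?_, fun u hu hfin => ?_⟩
  · simp [ENNReal.rpow_eq_zero_iff, h20, hV0, hp1.le]
  set m := ⨅ x ∈ B, u x
  have hm0 : m ≤ u 0 := iInf₂_le 0 (by simp [B])
  have hlow : (2 : ℝ≥0∞) ^ (α - n) * ∫⁻ y in B, u y ^ p ≤ m := by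
    refine le_iInf₂ fun x hx => ?_
    rw [hu.eq x, ← lintegral_const_mul' _ _
      (ENNReal.rpow_ne_top_of_ne_zero (by simp) (by simp))]
    refine le_trans (setLIntegral_mono' measurableSet_ball fun y hy => ?_)
      (setLIntegral_le_lintegral B _)
    refine mul_le_mul' (ENNReal.rpow_le_rpow_of_exponent_nonpos ?_ (by linarith)) le_rfl
    have h1 := mem_ball_zero_iff.1 hx
    have h2 := mem_ball_zero_iff.1 hy
    have h3 := norm_sub_le x y
    rw [← ofReal_norm]
    exact (ENNReal.ofReal_le_ofReal (by linarith : ‖x - y‖ ≤ 2)).trans (by simp)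
  have hmpos : m ≠ 0 := by
    refine (lt_of_lt_of_le (ENNReal.mul_pos h20 ?_) hlow).ne'
    have := (hu.measurable hαn).pow_const p
    rw [ne_eq, lintegral_eq_zero_iff this]
    intro h
    have h2 : ∀ᵐ x ∂volume.restrict B, False := by
      filter_upwards [h] with x hx
      exact hu.rpow_ne_zero hfin x p hx
    simp [hV0] at h2
  have hmtop : m ≠ ∞ := (hm0.trans_lt (lt_top_iff_ne_top.2 (hfin 0))).ne
  have hmp : (2 : ℝ≥0∞) ^ (α - n) * volume B * m ^ p ≤ m := by
    refine le_trans ?_ hlow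
    rw [mul_assoc]
    gcongr
    calc volume B * m ^ p = ∫⁻ y in B, m ^ p := by simp [mul_comm]
      _ ≤ _ := setLIntegral_mono' measurableSet_ball fun y hy => by
          gcongr
          exact iInf₂_le y hy
  have hm1 : (2 : ℝ≥0∞) ^ (α - n) * volume B ≤ m ^ (1 - p) := by
    rw [ENNReal.rpow_sub _ _ hmpos hmtop, ENNReal.rpow_one]
    exact (ENNReal.le_div_iff_mul_le
      (Or.inl (ENNReal.rpow_pos (pos_iff_ne_zero.2 hmpos) hmtop).ne')
      (Or.inl (ENNReal.rpow_ne_top_of_ne_zero hmpos hmtop))).2 hmp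
  rw [one_div]
  exact ((ENNReal.rpow_inv_le_iff (by linarith)).2 hm1).trans hm0

/-- Scaling makes the value of a solution at the origin arbitrarily small when `p < 1`, against the
universal lower bound. -/
theorem not_isEverywhereFinite_of_lt_one (hu : IsPositiveSolution n α p u) (hα : 0 < α)
    (hαn : α < n) (hp : p < 1) : ¬ IsEverywhereFinite u := by
  intro hfin
  obtain ⟨c, hc, H⟩ : ∃ c : ℝ≥0∞, c ≠ 0 ∧ ∀ u : EuclideanSpace ℝ (Fin n) → ℝ≥0∞,
      IsPositiveSolution n α p u → IsEverywhereFinite u → c ≤ u 0 := by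
    rcases lt_or_ge p 0 with h | h
    · obtain ⟨c, hc, H⟩ := exists_le_apply_zero_of_neg hα hαn h
      exact ⟨c, hc, fun u hu _ => H u hu⟩
    · exact exists_le_apply_zero_of_nonneg hαn h hp
  have hc' : c ≠ ∞ := ((H u hu hfin).trans_lt (lt_top_iff_ne_top.2 (hfin 0))).ne
  set γ := α / (p - 1)
  have hγ : γ ≠ 0 := div_ne_zero hα.ne' (by linarith)
  have h0 : c / 2 / u 0 ≠ 0 := by simp [ENNReal.div_eq_zero_iff, hc, hfin 0]
  have ht : c / 2 / u 0 ≠ ∞ :=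
    ENNReal.div_ne_top (ENNReal.div_ne_top hc' (by simp)) (hu.pos 0).ne'
  set ρ := (c / 2 / u 0) ^ γ⁻¹ with hρ
  have hρ0 : ρ ≠ 0 := (ENNReal.rpow_pos (pos_iff_ne_zero.2 h0) ht).ne'
  have hρt : ρ ≠ ∞ := ENNReal.rpow_ne_top_of_ne_zero h0 ht
  have hR : 0 < ρ.toReal := ENNReal.toReal_pos hρ0 hρt
  have hv := H _ (hu.scale hαn hp.ne hR) fun x => by
    rw [ENNReal.ofReal_toReal hρt]
    exact ENNReal.mul_ne_top (ENNReal.rpow_ne_top_of_ne_zero hρ0 hρt) (hfin _)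
  rw [ENNReal.ofReal_toReal hρt, smul_zero, hρ, ← ENNReal.rpow_mul, inv_mul_cancel₀ hγ,
    ENNReal.rpow_one, ENNReal.div_mul_cancel (hu.pos 0).ne' (hfin 0)] at hv
  exact (ENNReal.half_lt_self hc hc').not_ge hv

end IsPositiveSolution

/-! ### Inversion in a sphere -/

section Inversion

variable {n : ℕ} {α p r : ℝ} {y z : EuclideanSpace ℝ (Fin n)}

theorem inversion_zero_apply (r : ℝ) (y : EuclideanSpace ℝ (Fin n)) :
    inversion 0 r y = (r / ‖y‖) ^ 2 • y := by
  simp [inversion]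

theorem measurable_inversion_zero (r : ℝ) :
    Measurable (inversion (0 : EuclideanSpace ℝ (Fin n)) r) := by
  simp_rw [funext (inversion_zero_apply (n := n) r)]
  fun_prop

theorem norm_inversion_zero (r : ℝ) (y : EuclideanSpace ℝ (Fin n)) :
    ‖inversion 0 r y‖ = r ^ 2 / ‖y‖ := by
  simpa using EuclideanGeometry.dist_inversion_center 0 y r

theorem enorm_inversion_sub_inversion (hr : 0 < r) (hy : y ≠ 0) (hz : z ≠ 0) :
    ‖inversion 0 r y - inversion 0 r z‖ₑ =
      ENNReal.ofReal (r / ‖y‖) * ENNReal.ofReal (r / ‖z‖) * ‖y - z‖ₑ := by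
  have := EuclideanGeometry.dist_inversion_inversion hy hz r
  simp only [dist_eq_norm, sub_zero] at this
  rw [← ofReal_norm, this, ← ofReal_norm, ← ENNReal.ofReal_mul (by positivity),
    ← ENNReal.ofReal_mul (by positivity)]
  congr 1
  ring

theorem enorm_sub_inversion (hr : 0 < r) (hy : y ≠ 0) (hz : z ≠ 0) :
    ‖y - inversion 0 r z‖ₑ =
      ENNReal.ofReal (r / ‖z‖) * (ENNReal.ofReal (r / ‖y‖))⁻¹ * ‖inversion 0 r y - z‖ₑ := by
  have hy' := norm_pos_iff.2 hy
  have hz' := norm_pos_iff.2 hz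
  have h := EuclideanGeometry.dist_inversion_inversion
    (x := inversion 0 r y) (y := z) (c := 0) (by
      rwa [ne_eq, EuclideanGeometry.inversion_eq_center hr.ne']) hz r
  simp only [EuclideanGeometry.inversion_inversion _ hr.ne', dist_eq_norm, sub_zero,
    norm_inversion_zero] at h
  rw [← ofReal_norm, h, ← ofReal_norm, ← ENNReal.ofReal_inv_of_pos (by positivity),
    ← ENNReal.ofReal_mul (by positivity), ← ENNReal.ofReal_mul (by positivity)]
  congr 1
  field_simp

/-- Two points of a ball centred at the origin are closer to each other than, up to the conformal
factor, the reflection of one of them is to the other. -/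
theorem ofReal_mul_enorm_sub_lt (hy : y ≠ 0) (hyr : ‖y‖ < r) (hzr : ‖z‖ < r) :
    ENNReal.ofReal (r / ‖y‖) * ‖y - z‖ₑ < ‖inversion 0 r y - z‖ₑ := by
  have hy' := norm_pos_iff.2 hy
  have hr : 0 < r := hy'.trans hyr
  rw [← ofReal_norm, ← ofReal_norm, ← ENNReal.ofReal_mul (by positivity)]
  have key : (r / ‖y‖ * ‖y - z‖) ^ 2 < ‖inversion 0 r y - z‖ ^ 2 := by
    rw [mul_pow, inversion_zero_apply, norm_sub_sq_real, norm_sub_sq_real, norm_smul,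
      real_inner_smul_left, Real.norm_of_nonneg (by positivity)]
    have h : 0 < (r ^ 2 - ‖z‖ ^ 2) * (r ^ 2 - ‖y‖ ^ 2) / ‖y‖ ^ 2 := by
      have h1 : ‖z‖ ^ 2 < r ^ 2 := by gcongr
      have h2 : ‖y‖ ^ 2 < r ^ 2 := by gcongr
      have h3 := sub_pos.2 h1
      have h4 := sub_pos.2 h2
      positivity
    rw [← sub_pos]
    convert h using 1
    field_simp
    ring
  have h := lt_of_pow_lt_pow_left₀ 2 (norm_nonneg _) key
  exact (ENNReal.ofReal_lt_ofReal_iff (lt_of_le_of_lt (by positivity) h)).2 h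

/-- The Riesz kernel reflected in the sphere of radius `r` about the origin. -/
noncomputable def reflectedKernel (n : ℕ) (α r : ℝ) (y z : EuclideanSpace ℝ (Fin n)) : ℝ≥0∞ :=
  ENNReal.ofReal (r / ‖y‖) ^ (n - α) * ‖inversion 0 r y - z‖ₑ ^ (α - n)

theorem measurable_reflectedKernel (y : EuclideanSpace ℝ (Fin n)) :
    Measurable (reflectedKernel n α r y) := by
  unfold reflectedKernel
  fun_prop

theorem ofReal_div_norm_ne_zero (hr : 0 < r) (hy : y ≠ 0) : ENNReal.ofReal (r / ‖y‖) ≠ 0 := by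
  have := norm_pos_iff.2 hy
  simp only [ne_eq, ENNReal.ofReal_eq_zero, not_le]
  positivity

theorem reflectedKernel_lt (hαn : α < n) (hy : y ≠ 0) (hyr : ‖y‖ < r) (hzr : ‖z‖ < r) :
    reflectedKernel n α r y z < ‖y - z‖ₑ ^ (α - n) := by
  have h0 := ofReal_div_norm_ne_zero ((norm_nonneg y).trans_lt hyr) hy
  have hinv : reflectedKernel n α r y z =
      ((ENNReal.ofReal (r / ‖y‖))⁻¹ * ‖inversion 0 r y - z‖ₑ) ^ (α - n) := by
    rw [reflectedKernel, ENNReal.mul_rpow_of_ne_top (by simpa using h0) (by finiteness),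
      ENNReal.inv_rpow, ← ENNReal.rpow_neg, neg_sub]
  rw [hinv]
  refine ENNReal.rpow_lt_rpow_of_exponent_neg ?_ (by linarith)
  have := ofReal_mul_enorm_sub_lt hy hyr hzr
  rw [mul_comm, ← div_eq_mul_inv]
  rw [mul_comm] at this
  exact (ENNReal.lt_div_iff_mul_lt (Or.inl h0) (Or.inl ENNReal.ofReal_ne_top)).2 this

theorem lintegral_compl_closedBall (hr : 0 < r) (f : EuclideanSpace ℝ (Fin n) → ℝ≥0∞) :
    ∫⁻ z in (closedBall 0 r)ᶜ, f z =
      ∫⁻ z in ball 0 r \ {0}, ENNReal.ofReal (r / ‖z‖) ^ (2 * n : ℝ) * f (inversion 0 r z) := by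
  have himg : inversion 0 r '' (ball (0 : EuclideanSpace ℝ (Fin n)) r \ {0}) =
      (closedBall 0 r)ᶜ := by
    ext z
    constructor
    · rintro ⟨y, ⟨hy, hy0⟩, rfl⟩
      have hy' : 0 < ‖y‖ := norm_pos_iff.2 hy0
      simp only [mem_ball_zero_iff] at hy
      simp only [mem_compl_iff, mem_closedBall_zero_iff, not_le, norm_inversion_zero]
      rw [lt_div_iff₀ hy']
      nlinarith
    · intro hz
      simp only [mem_compl_iff, mem_closedBall_zero_iff, not_le] at hz
      have hz' : 0 < ‖z‖ := hr.trans hz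
      refine ⟨inversion 0 r z, ⟨?_, ?_⟩, EuclideanGeometry.inversion_inversion _ hr.ne' _⟩
      · rw [mem_ball_zero_iff, norm_inversion_zero, div_lt_iff₀ hz']
        nlinarith
      · rw [mem_singleton_iff, EuclideanGeometry.inversion_eq_center hr.ne']
        exact norm_pos_iff.1 hz'
  rw [← himg, lintegral_image_eq_lintegral_abs_det_fderiv_mul volume
    (measurableSet_ball.diff (measurableSet_singleton 0))
    (fun x hx => (EuclideanGeometry.hasFDerivAt_inversion (R := r) hx.2).hasFDerivWithinAt)
    ((EuclideanGeometry.inversion_injective 0 hr.ne').injOn)]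
  refine setLIntegral_congr_fun (measurableSet_ball.diff (measurableSet_singleton 0)) ?_
  intro z hz
  have hz' : 0 < ‖z‖ := norm_pos_iff.2 hz.2
  have hpos : 0 < r / ‖z‖ := by positivity
  have hdet : |((r / dist z 0) ^ 2 •
      ((ℝ ∙ (z - 0))ᗮ.reflection : EuclideanSpace ℝ (Fin n) →L[ℝ] EuclideanSpace ℝ (Fin n))).det| =
      (r / ‖z‖) ^ (2 * n : ℝ) := by
    have hrefl : LinearMap.det (((ℝ ∙ (z - 0))ᗮ.reflection : EuclideanSpace ℝ (Fin n) →L[ℝ]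
        EuclideanSpace ℝ (Fin n)) : EuclideanSpace ℝ (Fin n) →ₗ[ℝ] EuclideanSpace ℝ (Fin n)) =
        (-1) ^ Module.finrank ℝ ((ℝ ∙ (z - 0))ᗮᗮ : Submodule ℝ (EuclideanSpace ℝ (Fin n))) :=
      Submodule.det_reflection _
    rw [ContinuousLinearMap.det, ContinuousLinearMap.toLinearMap_smul, LinearMap.det_smul, hrefl,
      abs_mul, abs_neg_one_pow, mul_one, dist_zero_right,
      finrank_euclideanSpace, Fintype.card_fin, abs_of_pos (by positivity), ← pow_mul,
      ← Real.rpow_natCast]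
    push_cast
    rfl
  beta_reduce
  rw [hdet, ENNReal.ofReal_rpow_of_pos hpos]

/-- Integration over the whole space, with the exterior of the ball folded into the ball by
inversion. -/
theorem lintegral_eq_setLIntegral_ball_add (hr : 0 < r) (hn : n ≠ 0)
    (f : EuclideanSpace ℝ (Fin n) → ℝ≥0∞) :
    ∫⁻ z, f z = (∫⁻ z in ball 0 r, f z) +
      ∫⁻ z in ball 0 r, ENNReal.ofReal (r / ‖z‖) ^ (2 * n : ℝ) * f (inversion 0 r z) := by
  have hne : Nonempty (Fin n) := ⟨⟨0, Nat.pos_of_ne_zero hn⟩⟩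
  have h1 : (ball 0 r : Set (EuclideanSpace ℝ (Fin n))) =ᵐ[volume] closedBall 0 r := by
    refine ae_eq_set.2 ⟨?_, ?_⟩
    · rw [sdiff_eq_bot_iff.2 ball_subset_closedBall]
      exact measure_empty
    · rw [closedBall_sdiff_ball]
      exact Measure.addHaar_sphere _ _ _
  have h2 : (ball 0 r \ {0} : Set (EuclideanSpace ℝ (Fin n))) =ᵐ[volume] ball 0 r :=
    sdiff_null_ae_eq_self (measure_singleton 0)
  have h3 : ∫⁻ z in (ball 0 r)ᶜ, f z = ∫⁻ z in (closedBall 0 r)ᶜ, f z :=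
    setLIntegral_congr (ae_eq_set_compl_compl.2 h1)
  rw [← lintegral_add_compl f (measurableSet_ball (x := (0 : EuclideanSpace ℝ (Fin n))) (ε := r)),
    h3, lintegral_compl_closedBall hr, setLIntegral_congr h2]

/-- The Kelvin transform of `u` in the sphere of radius `r` about the origin. Its value at the origin
is a junk value and never used. -/
noncomputable def kelvin (n : ℕ) (α r : ℝ) (u : EuclideanSpace ℝ (Fin n) → ℝ≥0∞)
    (y : EuclideanSpace ℝ (Fin n)) : ℝ≥0∞ :=
  ENNReal.ofReal (r / ‖y‖) ^ (n - α) * u (inversion 0 r y)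

/-- The density on the ball obtained by folding `u ^ p` from the exterior into the ball. -/
noncomputable def foldedDensity (n : ℕ) (α p r : ℝ) (u : EuclideanSpace ℝ (Fin n) → ℝ≥0∞)
    (z : EuclideanSpace ℝ (Fin n)) : ℝ≥0∞ :=
  ENNReal.ofReal (r / ‖z‖) ^ (n + α) * u (inversion 0 r z) ^ p

theorem measurable_kelvin {u : EuclideanSpace ℝ (Fin n) → ℝ≥0∞} (hu : Measurable u) :
    Measurable (kelvin n α r u) := by
  have := hu.comp (measurable_inversion_zero (n := n) r)
  unfold kelvin
  exact Measurable.mul (by fun_prop) this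

theorem measurable_foldedDensity {u : EuclideanSpace ℝ (Fin n) → ℝ≥0∞} (hu : Measurable u) :
    Measurable (foldedDensity n α p r u) := by
  have := (hu.comp (measurable_inversion_zero (n := n) r)).pow_const p
  unfold foldedDensity
  exact Measurable.mul (by fun_prop) this

theorem ae_restrict_ball_ne_zero (hn : n ≠ 0) :
    ∀ᵐ z ∂(volume : Measure (EuclideanSpace ℝ (Fin n))).restrict (ball 0 r), z ≠ 0 := by
  have : Nonempty (Fin n) := ⟨⟨0, Nat.pos_of_ne_zero hn⟩⟩
  exact ae_restrict_of_ae (compl_mem_ae_iff.2 (measure_singleton 0))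

namespace IsPositiveSolution

variable {u : EuclideanSpace ℝ (Fin n) → ℝ≥0∞}

theorem eq_setLIntegral_ball (hu : IsPositiveSolution n α p u) (hn : n ≠ 0) (hαn : α < n)
    (hr : 0 < r) (hy : y ≠ 0) :
    u y = ∫⁻ z in ball 0 r, (‖y - z‖ₑ ^ (α - n) * u z ^ p +
      reflectedKernel n α r y z * foldedDensity n α p r u z) := by
  have hm := hu.measurable hαn
  rw [lintegral_add_left (by fun_prop), hu.eq y, lintegral_eq_setLIntegral_ball_add hr hn]
  congr 1
  refine lintegral_congr_ae ?_
  filter_upwards [ae_restrict_ball_ne_zero hn] with z hz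
  have hy0 := ofReal_div_norm_ne_zero hr hy
  have hz0 := ofReal_div_norm_ne_zero hr hz
  have hzt : ENNReal.ofReal (r / ‖z‖) ≠ ∞ := ENNReal.ofReal_ne_top
  rw [enorm_sub_inversion hr hy hz, reflectedKernel, foldedDensity,
    ENNReal.mul_rpow_of_ne_top (ENNReal.mul_ne_top hzt (ENNReal.inv_ne_top.2 hy0)) (by finiteness),
    ENNReal.mul_rpow_of_ne_top hzt (ENNReal.inv_ne_top.2 hy0), ENNReal.inv_rpow,
    ← ENNReal.rpow_neg, neg_sub,
    show (n + α : ℝ) = 2 * n + (α - n) by ring, ENNReal.rpow_add _ _ hz0 hzt]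
  ring

theorem kelvin_eq_setLIntegral_ball (hu : IsPositiveSolution n α p u) (hn : n ≠ 0) (hαn : α < n)
    (hr : 0 < r) (hy : y ≠ 0) :
    kelvin n α r u y = ∫⁻ z in ball 0 r, (reflectedKernel n α r y z * u z ^ p +
      ‖y - z‖ₑ ^ (α - n) * foldedDensity n α p r u z) := by
  have hm := hu.measurable hαn
  have hy0 := ofReal_div_norm_ne_zero hr hy
  have hyt : ENNReal.ofReal (r / ‖y‖) ≠ ∞ := ENNReal.ofReal_ne_top
  have hc : ENNReal.ofReal (r / ‖y‖) ^ (n - α) ≠ ∞ := ENNReal.rpow_ne_top_of_ne_zero hy0 hyt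
  have hmeas : Measurable fun z => reflectedKernel n α r y z * u z ^ p :=
    (measurable_reflectedKernel y).mul (hm.pow_const p)
  rw [lintegral_add_left hmeas, kelvin,
    hu.eq (inversion 0 r y), lintegral_eq_setLIntegral_ball_add hr hn, mul_add]
  congr 1
  · rw [← lintegral_const_mul' _ _ hc]
    simp only [reflectedKernel, mul_assoc]
  · rw [← lintegral_const_mul' _ _ hc]
    refine lintegral_congr_ae ?_
    filter_upwards [ae_restrict_ball_ne_zero hn] with z hz
    have hz0 := ofReal_div_norm_ne_zero hr hz
    have hzt : ENNReal.ofReal (r / ‖z‖) ≠ ∞ := ENNReal.ofReal_ne_top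
    have hcancel : ENNReal.ofReal (r / ‖y‖) ^ (n - α) * ENNReal.ofReal (r / ‖y‖) ^ (α - n) = 1 := by
      rw [← ENNReal.rpow_add _ _ hy0 hyt, sub_add_sub_cancel, sub_self, ENNReal.rpow_zero]
    rw [enorm_inversion_sub_inversion hr hy hz, foldedDensity,
      ENNReal.mul_rpow_of_ne_top (ENNReal.mul_ne_top hyt hzt) (by finiteness),
      ENNReal.mul_rpow_of_ne_top hyt hzt,
      show (n + α : ℝ) = 2 * n + (α - n) by ring, ENNReal.rpow_add _ _ hz0 hzt]
    calc _ = (ENNReal.ofReal (r / ‖y‖) ^ (n - α) * ENNReal.ofReal (r / ‖y‖) ^ (α - n)) *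
          (ENNReal.ofReal (r / ‖z‖) ^ (2 * n : ℝ) * ENNReal.ofReal (r / ‖z‖) ^ (α - n) *
            ‖y - z‖ₑ ^ (α - n) * u (inversion 0 r z) ^ p) := by ring
      _ = _ := by rw [hcancel]; ring

end IsPositiveSolution

end Inversion

/-! ### Moving spheres -/

theorem ENNReal.rpow_sub_rpow_le {a b : ℝ≥0∞} {p : ℝ} (ha : a ≠ ∞) (hab : b ≤ a) (hp : 1 ≤ p) :
    a ^ p - b ^ p ≤ ENNReal.ofReal p * a ^ (p - 1) * (a - b) := by
  have hb : b ≠ ∞ := ne_top_of_le_ne_top ha hab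
  lift a to NNReal using ha
  lift b to NNReal using hb
  have hab' : b ≤ a := by exact_mod_cast hab
  have hp0 : 0 ≤ p := by linarith
  rw [← ENNReal.coe_rpow_of_nonneg _ hp0, ← ENNReal.coe_rpow_of_nonneg _ hp0,
    ← ENNReal.coe_rpow_of_nonneg _ (by linarith), ← ENNReal.coe_sub, ← ENNReal.coe_sub,
    ENNReal.ofReal, ← ENNReal.coe_mul, ← ENNReal.coe_mul, ENNReal.coe_le_coe, tsub_le_iff_right,
    ← NNReal.coe_le_coe]
  push_cast [NNReal.coe_sub hab', Real.coe_toNNReal p hp0]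
  rcases eq_or_lt_of_le (NNReal.coe_nonneg a) with h | h
  · have hb0 : (b : ℝ) = 0 := le_antisymm (by rw [h]; exact_mod_cast hab') b.2
    rw [← h, hb0, Real.zero_rpow (by linarith)]
    simp
  · -- Bernoulli's inequality for `b / a = 1 + s`.
    have hB := one_add_mul_self_le_rpow_one_add (s := (b : ℝ) / a - 1)
      (by linarith [div_nonneg b.coe_nonneg a.coe_nonneg]) hp
    rw [add_sub_cancel, Real.div_rpow b.coe_nonneg a.coe_nonneg,
      le_div_iff₀ (by positivity)] at hB
    have e : (a : ℝ) ^ p = a ^ (p - 1) * a := by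
      rw [← Real.rpow_add_one h.ne', sub_add_cancel]
    have e2 : (1 + p * ((b : ℝ) / a - 1)) * a ^ p = a ^ p + p * a ^ (p - 1) * (b - a) := by
      rw [e]
      field_simp
    rw [e2] at hB
    linarith

theorem ENNReal.mul_add_mul_le_swap_add {a b c d : ℝ≥0∞} (hba : b ≤ a) :
    a * c + b * d ≤ b * c + a * d + a * (c - d) := by
  rcases le_total c d with h | h
  · obtain ⟨e, rfl⟩ := exists_add_of_le h
    calc a * c + b * (c + e) = b * c + a * c + b * e := by ring
      _ ≤ b * c + a * c + a * e := by gcongr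
      _ = b * c + a * (c + e) := by ring
      _ ≤ _ := le_self_add
  · calc a * c + b * d ≤ a * (d + (c - d)) + b * c := by
          gcongr
          exact le_add_tsub
      _ = _ := by ring

theorem ENNReal.mul_add_mul_lt_swap {a b c d : ℝ≥0∞} (ha : a ≠ ∞) (hd : d ≠ ∞) (hba : b < a)
    (hcd : c < d) : a * c + b * d < b * c + a * d := by
  have hb : b ≠ ∞ := hba.ne_top
  have hc : c ≠ ∞ := hcd.ne_top
  lift a to NNReal using ha
  lift b to NNReal using hb
  lift c to NNReal using hc
  lift d to NNReal using hd
  norm_cast at *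
  rw [← NNReal.coe_lt_coe] at *
  push_cast
  have h1 : (0 : ℝ) < a - b := sub_pos.2 hba
  have h2 : (0 : ℝ) < d - c := sub_pos.2 hcd
  nlinarith [_root_.mul_pos h1 h2]

section MovingSpheres

variable {n : ℕ} {α p r : ℝ} {u : EuclideanSpace ℝ (Fin n) → ℝ≥0∞}

/-- Inside the sphere of radius `r` about the origin, `u` lies below its Kelvin transform. -/
def LeKelvin (n : ℕ) (α r : ℝ) (u : EuclideanSpace ℝ (Fin n) → ℝ≥0∞) : Prop :=
  ∀ y, y ≠ 0 → ‖y‖ < r → u y ≤ kelvin n α r u y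

/-- The points at which `LeKelvin` fails. -/
def badSet (n : ℕ) (α r : ℝ) (u : EuclideanSpace ℝ (Fin n) → ℝ≥0∞) :
    Set (EuclideanSpace ℝ (Fin n)) :=
  (ball 0 r \ {0}) ∩ {y | kelvin n α r u y < u y}

theorem measurableSet_badSet (hu : Measurable u) : MeasurableSet (badSet n α r u) :=
  (measurableSet_ball.diff (measurableSet_singleton 0)).inter
    (measurableSet_lt (measurable_kelvin hu) hu)

theorem kelvin_rpow_le_foldedDensity {z : EuclideanSpace ℝ (Fin n)} (hp0 : 0 ≤ p)
    (hp : p * (n - α) ≤ n + α) (hz : z ≠ 0) (hzr : ‖z‖ < r) :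
    kelvin n α r u z ^ p ≤ foldedDensity n α p r u z := by
  have hz' := norm_pos_iff.2 hz
  rw [kelvin, foldedDensity, ENNReal.mul_rpow_of_nonneg _ _ hp0, ← ENNReal.rpow_mul]
  gcongr
  · rw [ENNReal.one_le_ofReal, one_le_div hz']
    exact hzr.le
  · linarith

namespace IsPositiveSolution

theorem le_kelvin_add_setLIntegral (hu : IsPositiveSolution n α p u) (hn : n ≠ 0) (hαn : α < n)
    {y : EuclideanSpace ℝ (Fin n)} (hy : y ≠ 0) (hyr : ‖y‖ < r) :
    u y ≤ kelvin n α r u y +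
      ∫⁻ z in ball 0 r, ‖y - z‖ₑ ^ (α - n) * (u z ^ p - foldedDensity n α p r u z) := by
  have hr : 0 < r := (norm_nonneg y).trans_lt hyr
  have hm := hu.measurable hαn
  have hmeas : Measurable fun z => reflectedKernel n α r y z * u z ^ p +
      ‖y - z‖ₑ ^ (α - n) * foldedDensity n α p r u z :=
    ((measurable_reflectedKernel y).mul (hm.pow_const p)).add
      (Measurable.mul (by fun_prop) (measurable_foldedDensity hm))
  rw [hu.kelvin_eq_setLIntegral_ball hn hαn hr hy, ← lintegral_add_left hmeas]
  conv_lhs => rw [hu.eq_setLIntegral_ball hn hαn hr hy]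
  refine setLIntegral_mono' measurableSet_ball fun z hz => ?_
  exact ENNReal.mul_add_mul_le_swap_add
    (reflectedKernel_lt hαn hy hyr (mem_ball_zero_iff.1 hz)).le

/-- If `u` exceeds its Kelvin transform only on a small set, it never does: the largest excess `W`
satisfies `W ≤ W / 2`. -/
theorem exists_pos_leKelvin_of_volume_lt (hu : IsPositiveSolution n α p u) (hα : 0 < α)
    (hαn : α < n) (hp1 : 1 ≤ p) (hp : p * (n - α) ≤ n + α) {ρ : ℝ} {M : ℝ≥0∞} (hM : M ≠ ∞)
    (hbdd : ∀ x ∈ ball 0 ρ, u x ≤ M) :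
    ∃ δ > 0, ∀ r ≤ ρ, volume (badSet n α r u) < δ → LeKelvin n α r u := by
  have hn : n ≠ 0 := by
    rintro rfl
    simp at hαn
    linarith
  set c := ENNReal.ofReal p * M ^ (p - 1)
  have hc : c ≠ ∞ := ENNReal.mul_ne_top ENNReal.ofReal_ne_top
    (ENNReal.rpow_ne_top_of_nonneg (by linarith) hM)
  obtain ⟨δ, hδ, H⟩ := exists_pos_setLIntegral_kernel_le hα hαn
    (ε := (2 * (c + 1))⁻¹) (by simp [ENNReal.mul_eq_top, hc])
  refine ⟨δ, hδ, fun r hr hvol => ?_⟩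
  set W := ⨆ y ∈ ball (0 : EuclideanSpace ℝ (Fin n)) r \ {0}, (u y - kelvin n α r u y)
  have hWM : W ≤ M := iSup₂_le fun y hy => tsub_le_self.trans
    (hbdd y (ball_subset_ball hr hy.1))
  have hW : ∀ y ∈ ball (0 : EuclideanSpace ℝ (Fin n)) r \ {0}, u y - kelvin n α r u y ≤ W :=
    fun y hy => le_iSup₂ (f := fun y _ => u y - kelvin n α r u y) y hy
  have hpt : ∀ z ∈ ball (0 : EuclideanSpace ℝ (Fin n)) r \ {0},
      u z ^ p - foldedDensity n α p r u z ≤ (badSet n α r u).indicator (fun _ => c * W) z := by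
    intro z hz
    have hfold := kelvin_rpow_le_foldedDensity (u := u) (by linarith : 0 ≤ p) hp hz.2
      (mem_ball_zero_iff.1 hz.1)
    by_cases hlt : kelvin n α r u z < u z
    · rw [indicator_of_mem (show z ∈ badSet n α r u from ⟨hz, hlt⟩)]
      have hzM := hbdd z (ball_subset_ball hr hz.1)
      calc _ ≤ u z ^ p - kelvin n α r u z ^ p := tsub_le_tsub_left hfold _
        _ ≤ ENNReal.ofReal p * u z ^ (p - 1) * (u z - kelvin n α r u z) :=
            ENNReal.rpow_sub_rpow_le (ne_top_of_le_ne_top hM hzM) hlt.le hp1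
        _ ≤ _ := by
            have : u z ^ (p - 1) ≤ M ^ (p - 1) := ENNReal.rpow_le_rpow hzM (by linarith)
            exact mul_le_mul' (mul_le_mul' le_rfl this) (hW z hz)
    · have : u z ^ p ≤ foldedDensity n α p r u z :=
        (ENNReal.rpow_le_rpow (not_lt.1 hlt) (by linarith)).trans hfold
      rw [tsub_eq_zero_of_le this]
      exact zero_le
  have hhalf : W ≤ W / 2 := by
    refine iSup₂_le fun y hy => ?_
    rw [tsub_le_iff_left]
    refine (hu.le_kelvin_add_setLIntegral hn hαn hy.2 (mem_ball_zero_iff.1 hy.1)).trans ?_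
    gcongr
    calc ∫⁻ z in ball 0 r, ‖y - z‖ₑ ^ (α - n) * (u z ^ p - foldedDensity n α p r u z)
        ≤ ∫⁻ z in ball 0 r, (badSet n α r u).indicator
            (fun z => ‖y - z‖ₑ ^ (α - n) * (c * W)) z := by
          refine lintegral_mono_ae ?_
          filter_upwards [ae_restrict_ball_ne_zero hn, ae_restrict_mem measurableSet_ball]
            with z hz hzr
          refine (mul_le_mul' le_rfl (hpt z ⟨hzr, hz⟩)).trans_eq ?_
          by_cases hzb : z ∈ badSet n α r u <;> simp [hzb]
      _ ≤ ∫⁻ z, (badSet n α r u).indicator (fun z => ‖y - z‖ₑ ^ (α - n) * (c * W)) z :=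
          setLIntegral_le_lintegral _ _
      _ = (∫⁻ z in badSet n α r u, ‖y - z‖ₑ ^ (α - n)) * (c * W) := by
          rw [lintegral_indicator (measurableSet_badSet (hu.measurable hαn)),
            lintegral_mul_const _ (by fun_prop)]
      _ ≤ (2 * (c + 1))⁻¹ * ((c + 1) * W) := by
          gcongr
          · exact H _ hvol y
          · exact le_self_add
      _ = W / 2 := by
          rw [ENNReal.mul_inv (by simp) (by simp), mul_assoc, ← mul_assoc (c + 1)⁻¹,
            ENNReal.inv_mul_cancel (by simp) (by simp [hc]), one_mul, mul_comm, div_eq_mul_inv]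
  have hW0 : W = 0 := by
    by_contra h
    exact (ENNReal.half_lt_self h (ne_top_of_le_ne_top hM hWM)).not_ge hhalf
  intro y hy hyr
  rw [← tsub_eq_zero_iff_le]
  exact le_antisymm ((hW y ⟨mem_ball_zero_iff.2 hyr, hy⟩).trans_eq hW0) zero_le

/-- For a subcritical exponent, the comparison with the Kelvin transform is strict. -/
theorem lt_kelvin (hu : IsPositiveSolution n α p u) (hfin : IsEverywhereFinite u) (hn : n ≠ 0)
    (hαn : α < n) (hp0 : 0 ≤ p) (hp : p * (n - α) < n + α) (h : LeKelvin n α r u)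
    {y : EuclideanSpace ℝ (Fin n)} (hy : y ≠ 0) (hyr : ‖y‖ < r) : u y < kelvin n α r u y := by
  have hr : 0 < r := (norm_nonneg y).trans_lt hyr
  have hm := hu.measurable hαn
  have hmeas : Measurable fun z => reflectedKernel n α r y z * u z ^ p +
      ‖y - z‖ₑ ^ (α - n) * foldedDensity n α p r u z :=
    ((measurable_reflectedKernel y).mul (hm.pow_const p)).add
      (Measurable.mul (by fun_prop) (measurable_foldedDensity hm))
  have hball : (volume : Measure (EuclideanSpace ℝ (Fin n))).restrict (ball 0 r) ≠ 0 := by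
    rw [ne_eq, Measure.restrict_eq_zero]
    exact (measure_ball_pos volume 0 hr).ne'
  have hne : Nonempty (Fin n) := ⟨⟨0, Nat.pos_of_ne_zero hn⟩⟩
  rw [hu.kelvin_eq_setLIntegral_ball hn hαn hr hy]
  have heq := hu.eq_setLIntegral_ball hn hαn hr hy
  rw [heq]
  refine lintegral_strict_mono hball hmeas.aemeasurable (heq ▸ hfin y) ?_
  filter_upwards [ae_restrict_ball_ne_zero hn, ae_restrict_mem measurableSet_ball,
    ae_restrict_of_ae (compl_mem_ae_iff.2 (measure_singleton y))] with z hz hzr hzy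
  have hzr' := mem_ball_zero_iff.1 hzr
  have hz' := norm_pos_iff.2 hz
  have hl0 := ofReal_div_norm_ne_zero hr hz
  refine ENNReal.mul_add_mul_lt_swap ?_ ?_ (reflectedKernel_lt hαn hy hyr hzr') ?_
  · refine ENNReal.rpow_ne_top_of_ne_zero ?_ (by finiteness)
    rw [ne_eq, enorm_eq_zero, sub_eq_zero]
    exact fun h => hzy h.symm
  · exact ENNReal.mul_ne_top (ENNReal.rpow_ne_top_of_ne_zero hl0 ENNReal.ofReal_ne_top)
      (hu.rpow_ne_top hfin _ _)
  · calc u z ^ p ≤ kelvin n α r u z ^ p := ENNReal.rpow_le_rpow (h z hz hzr') hp0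
      _ = ENNReal.ofReal (r / ‖z‖) ^ ((n - α) * p) * u (inversion 0 r z) ^ p := by
          rw [kelvin, ENNReal.mul_rpow_of_nonneg _ _ hp0, ← ENNReal.rpow_mul]
      _ < foldedDensity n α p r u z := by
          refine ENNReal.mul_lt_mul_left (hu.rpow_ne_zero hfin _ _) (hu.rpow_ne_top hfin _ _) ?_
          refine ENNReal.rpow_lt_rpow_of_exponent_lt ?_ ENNReal.ofReal_ne_top (by linarith)
          rw [ENNReal.one_lt_ofReal, one_lt_div hz']
          exact hzr'

/-- The sphere can be enlarged. For `r = 0` this starts the process. -/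
theorem eventually_leKelvin (hu : IsPositiveSolution n α p u) (hfin : IsEverywhereFinite u)
    (hα : 0 < α) (hαn : α < n) (hp1 : 1 ≤ p) (hp : p * (n - α) < n + α) {ρ : ℝ} {M : ℝ≥0∞}
    (hM : M ≠ ∞) (hbdd : ∀ x ∈ ball 0 ρ, u x ≤ M) (hrρ : r < ρ) (h : LeKelvin n α r u) :
    ∀ᶠ s in 𝓝[>] r, LeKelvin n α s u := by
  have hn : n ≠ 0 := by
    rintro rfl
    simp at hαn
    linarith
  have hne : Nonempty (Fin n) := ⟨⟨0, Nat.pos_of_ne_zero hn⟩⟩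
  obtain ⟨δ, hδ, H⟩ := hu.exists_pos_leKelvin_of_volume_lt hα hαn hp1 hp.le hM hbdd
  have hsρ : ∀ᶠ s in 𝓝[>] r, s < ρ := nhdsWithin_le_nhds (gt_mem_nhds hrρ)
  have hlim : Tendsto (fun s => volume (badSet n α s u)) (𝓝[>] r)
      (𝓝 (volume (∅ : Set (EuclideanSpace ℝ (Fin n))))) := by
    refine tendsto_measure_of_ae_tendsto_indicator _ MeasurableSet.empty
      (fun s => measurableSet_badSet (hu.measurable hαn)) (B := ball 0 ρ) measurableSet_ball
      measure_ball_lt_top.ne ?_ ?_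
    · filter_upwards [hsρ] with s hs
      exact fun y hy => ball_subset_ball hs.le hy.1.1
    · filter_upwards [compl_mem_ae_iff.2
        (Measure.addHaar_sphere (volume : Measure (EuclideanSpace ℝ (Fin n))) 0 r),
        compl_mem_ae_iff.2 (measure_singleton (0 : EuclideanSpace ℝ (Fin n)))] with y hy hy0
      rw [mem_compl_iff, mem_sphere_zero_iff_norm] at hy
      simp only [mem_empty_iff_false, iff_false]
      rcases lt_or_gt_of_ne hy with hyr | hyr
      · have hlt := hu.lt_kelvin hfin hn hαn (by linarith) hp h hy0 hyr
        have hr : 0 < r := (norm_nonneg y).trans_lt hyr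
        have hl0 := ofReal_div_norm_ne_zero hr hy0
        have hc0 : ENNReal.ofReal (r / ‖y‖) ^ (n - α) ≠ 0 :=
          (ENNReal.rpow_pos (pos_iff_ne_zero.2 hl0) ENNReal.ofReal_ne_top).ne'
        have hct : ENNReal.ofReal (r / ‖y‖) ^ (n - α) ≠ ∞ :=
          ENNReal.rpow_ne_top_of_ne_zero hl0 ENNReal.ofReal_ne_top
        rw [kelvin, mul_comm, ← ENNReal.div_lt_iff (Or.inl hc0) (Or.inl hct)] at hlt
        have hcont : Tendsto (fun s => inversion 0 s y) (𝓝[>] r) (𝓝 (inversion 0 r y)) := by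
          simp_rw [inversion_zero_apply]
          exact (Continuous.tendsto (by fun_prop) r).mono_left nhdsWithin_le_nhds
        filter_upwards [hcont.eventually (hu.lowerSemicontinuous hαn _ _ hlt),
          self_mem_nhdsWithin] with s hs hrs hbad
        rw [gt_iff_lt, ENNReal.div_lt_iff (Or.inl hc0) (Or.inl hct), mul_comm] at hs
        refine (hs.trans_le ?_).not_ge (le_of_lt hbad.2)
        rw [kelvin]
        gcongr
        exact le_of_lt hrs
      · filter_upwards [nhdsWithin_le_nhds (gt_mem_nhds hyr)] with s hs hbad
        exact (mem_ball_zero_iff.1 hbad.1.1).not_gt hs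
  rw [measure_empty] at hlim
  filter_upwards [hlim.eventually (gt_mem_nhds hδ), hsρ] with s hs hs'
  exact H s hs'.le hs

/-- The comparison passes to limits of radii, since `u` is lower semicontinuous and only the inner
point has to move. -/
theorem isClosed_setOf_leKelvin (hu : IsPositiveSolution n α p u) (hαn : α < n) (b : ℝ) :
    IsClosed ({r | LeKelvin n α r u} ∩ Icc 0 b) := by
  refine IsSeqClosed.isClosed fun s r hs hlim => ⟨?_, ?_⟩
  swap
  · exact isClosed_Icc.isSeqClosed (fun k => (hs k).2) hlim
  intro y hy hyr
  have hr : 0 < r := (norm_nonneg y).trans_lt hyr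
  have hy' := norm_pos_iff.2 hy
  set z := inversion 0 r y with hz
  have hz0 : z ≠ 0 := by rwa [hz, ne_eq, EuclideanGeometry.inversion_eq_center hr.ne']
  have hzz : inversion 0 r z = y := EuclideanGeometry.inversion_inversion _ hr.ne' _
  -- Keep the outer point `z` fixed and reflect it in the approximating spheres.
  have hcont : Tendsto (fun k => inversion 0 (s k) z) atTop (𝓝 y) := by
    rw [← hzz]
    simp_rw [inversion_zero_apply]
    exact (Continuous.tendsto (f := fun t : ℝ => (t / ‖z‖) ^ 2 • z) (by fun_prop) r).comp hlim
  have hnorm : Tendsto (fun k => ‖inversion 0 (s k) z‖) atTop (𝓝 ‖y‖) := hcont.norm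
  have hrhs : Tendsto (fun k => ENNReal.ofReal (s k / ‖inversion 0 (s k) z‖) ^ (n - α) * u z)
      atTop (𝓝 (ENNReal.ofReal (r / ‖y‖) ^ (n - α) * u z)) := by
    refine ENNReal.Tendsto.mul_const ?_ (Or.inl ?_)
    · exact (ENNReal.continuous_rpow_const.tendsto _).comp
        (ENNReal.tendsto_ofReal (hlim.div hnorm hy'.ne'))
    · exact (ENNReal.rpow_pos (pos_iff_ne_zero.2 (ofReal_div_norm_ne_zero hr hy))
        ENNReal.ofReal_ne_top).ne'
  by_contra! hlt
  obtain ⟨c, hc1, hc2⟩ := exists_between hlt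
  have hev := hcont.eventually (hu.lowerSemicontinuous hαn y c hc2)
  obtain ⟨k, hk1, hk2, hk3, hk4⟩ := (hev.and ((hrhs.eventually (gt_mem_nhds hc1)).and
    ((hlim.eventually (lt_mem_nhds hr)).and (hnorm.eventually_lt hlim hyr)))).exists
  have hne : inversion 0 (s k) z ≠ 0 := by
    rwa [ne_eq, EuclideanGeometry.inversion_eq_center hk3.ne']
  have hle := (hs k).1 _ hne hk4
  rw [kelvin, EuclideanGeometry.inversion_inversion _ hk3.ne'] at hle
  exact ((hk1.trans_le hle).trans hk2).false

/-- As long as `u` is bounded on a larger ball, the sphere never stops. -/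
theorem leKelvin_of_bddOn_ball (hu : IsPositiveSolution n α p u) (hfin : IsEverywhereFinite u)
    (hα : 0 < α) (hαn : α < n) (hp1 : 1 ≤ p) (hp : p * (n - α) < n + α) {ρ : ℝ} {M : ℝ≥0∞}
    (hM : M ≠ ∞) (hbdd : ∀ x ∈ ball 0 ρ, u x ≤ M) (hr : 0 ≤ r) (hrρ : r < ρ) :
    LeKelvin n α r u := by
  refine IsClosed.Icc_subset_of_forall_exists_gt (hu.isClosed_setOf_leKelvin hαn r) ?_ ?_
    (right_mem_Icc.2 hr)
  · intro y _ hy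
    exact absurd hy (norm_nonneg y).not_gt
  · intro s hs t ht
    have := hu.eventually_leKelvin hfin hα hαn hp1 hp hM hbdd (hs.2.2.trans hrρ) hs.1
    exact (this.and (Ioc_mem_nhdsGT ht)).exists

end IsPositiveSolution

end MovingSpheres

/-! ### Local boundedness and constancy -/

/-- The points near which `u` is unbounded. -/
def singularSet {n : ℕ} (u : EuclideanSpace ℝ (Fin n) → ℝ≥0∞) : Set (EuclideanSpace ℝ (Fin n)) :=
  {x | ¬ ∃ M : ℝ≥0∞, M ≠ ∞ ∧ ∀ᶠ x' in 𝓝 x, u x' ≤ M}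

section Singular

variable {n : ℕ} {α p : ℝ} {u : EuclideanSpace ℝ (Fin n) → ℝ≥0∞}

theorem isClosed_singularSet : IsClosed (singularSet u) := by
  rw [← isOpen_compl_iff, isOpen_iff_eventually]
  intro x hx
  simp only [singularSet, mem_compl_iff, mem_ofPred_eq, not_not] at hx
  obtain ⟨M, hM, h⟩ := hx
  filter_upwards [eventually_eventually_nhds.2 h] with x' hx'
  simp only [singularSet, mem_compl_iff, mem_ofPred_eq, not_not]
  exact ⟨M, hM, hx'⟩

theorem exists_bound_of_isCompact {K : Set (EuclideanSpace ℝ (Fin n))} (hK : IsCompact K)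
    (hKS : ∀ x ∈ K, x ∉ singularSet u) : ∃ M : ℝ≥0∞, M ≠ ∞ ∧ ∀ x ∈ K, u x ≤ M := by
  refine hK.induction_on (p := fun s => ∃ M : ℝ≥0∞, M ≠ ∞ ∧ ∀ x ∈ s, u x ≤ M) ?_ ?_ ?_ ?_
  · exact ⟨0, by simp, by simp⟩
  · rintro s t hst ⟨M, hM, h⟩
    exact ⟨M, hM, fun x hx => h x (hst hx)⟩
  · rintro s t ⟨M, hM, h⟩ ⟨M', hM', h'⟩
    refine ⟨max M M', by simp [hM, hM'], ?_⟩
    rintro x (hx | hx)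
    · exact (h x hx).trans (le_max_left _ _)
    · exact (h' x hx).trans (le_max_right _ _)
  · intro x hx
    have := hKS x hx
    simp only [singularSet, mem_ofPred_eq, not_not] at this
    obtain ⟨M, hM, h⟩ := this
    exact ⟨_, nhdsWithin_le_nhds h, M, hM, fun _ h => h⟩

namespace IsPositiveSolution

/-- A Harnack-type inequality: `z` is compared with `y` through the sphere that exchanges them and
whose centre lies on the line through `y` and `z`, at distance `t * ‖z - y‖` behind `z`. -/
theorem apply_le_of_bddOn_ball (hu : IsPositiveSolution n α p u) (hfin : IsEverywhereFinite u)
    (hα : 0 < α) (hαn : α < n) (hp1 : 1 ≤ p) (hp : p * (n - α) < n + α)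
    {y z : EuclideanSpace ℝ (Fin n)} (hyz : z ≠ y) {t ρ : ℝ} (ht : 0 < t)
    (hρ : √(t * (1 + t)) * ‖z - y‖ < ρ) {M : ℝ≥0∞} (hM : M ≠ ∞)
    (hbdd : ∀ x ∈ ball (z + t • (z - y)) ρ, u x ≤ M) :
    u z ≤ ENNReal.ofReal √((1 + t) / t) ^ (n - α) * u y := by
  have hd : 0 < ‖z - y‖ := norm_pos_iff.2 (sub_ne_zero.2 hyz)
  set c := z + t • (z - y)
  have hle := (hu.comp_add hαn c).leKelvin_of_bddOn_ball (r := √(t * (1 + t)) * ‖z - y‖)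
    (fun x => hfin _) hα hαn hp1 hp hM (ρ := ρ) (fun x hx => hbdd _ (by
      rwa [mem_ball, dist_eq_norm, add_sub_cancel_right, ← mem_ball_zero_iff]))
    (by positivity) hρ
  have hzc : ‖z - c‖ = t * ‖z - y‖ := by
    simp [c, norm_smul, abs_of_pos ht]
  have h := hle (z - c) (norm_pos_iff.1 (by rw [hzc]; positivity)) (by
    rw [hzc]
    gcongr
    apply Real.lt_sqrt_of_sq_lt
    nlinarith)
  have hratio : √(t * (1 + t)) * ‖z - y‖ / ‖z - c‖ = √((1 + t) / t) := by
    have hsq : √((1 + t) / t) * t = √((1 + t) / t) * √(t ^ 2) := by rw [Real.sqrt_sq ht.le]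
    rw [hzc, mul_div_mul_right _ _ hd.ne', div_eq_iff ht.ne', hsq, ← Real.sqrt_mul (by positivity)]
    congr 1
    field_simp
  have hinv : inversion 0 (√(t * (1 + t)) * ‖z - y‖) (z - c) + c = y := by
    rw [inversion_zero_apply, hratio, Real.sq_sqrt (by positivity)]
    have h1 : z - c = -(t • (z - y)) := by simp [c]
    rw [h1, smul_neg, smul_smul, div_mul_cancel₀ _ ht.ne']
    simp only [c]
    module
  simpa only [kelvin, hratio, hinv, sub_add_cancel] using h

/-- By Baire's theorem `u` is bounded on a relatively open part of the singular set; comparing the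
points nearby with their nearest singular points shows that this part is not singular. -/
theorem singularSet_eq_empty (hu : IsPositiveSolution n α p u) (hfin : IsEverywhereFinite u)
    (hα : 0 < α) (hαn : α < n) (hp1 : 1 ≤ p) (hp : p * (n - α) < n + α) :
    singularSet u = ∅ := by
  by_contra hne
  have hS : (singularSet u).Nonempty := nonempty_iff_ne_empty.2 hne
  have : Nonempty (singularSet u) := hS.to_subtype
  have : CompleteSpace (singularSet u) := isClosed_singularSet.completeSpace_coe
  have hclosed (k : ℕ) : IsClosed {x : singularSet u | u x ≤ k} :=
    ((hu.lowerSemicontinuous hαn).isClosed_preimage (k : ℝ≥0∞)).preimage continuous_subtype_val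
  have hcover : ⋃ k : ℕ, {x : singularSet u | u x ≤ k} = univ := by
    refine eq_univ_of_forall fun x => ?_
    obtain ⟨k, hk⟩ := ENNReal.exists_nat_gt (hfin x)
    exact mem_iUnion.2 ⟨k, hk.le⟩
  obtain ⟨k, s₀, hint⟩ := nonempty_interior_of_iUnion_of_closed hclosed hcover
  rw [mem_interior_iff_mem_nhds, Metric.mem_nhds_iff] at hint
  obtain ⟨ε, hε, hball⟩ := hint
  have hk : ∀ s ∈ singularSet u, dist s s₀ < ε → u s ≤ k := by
    intro s hs hd
    have hmem : (⟨s, hs⟩ : singularSet u) ∈ ball s₀ ε := hd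
    exact hball hmem
  set C := ENNReal.ofReal √((1 + 1 / 4) / (1 / 4)) ^ (n - α)
  have hC : C ≠ ∞ := ENNReal.rpow_ne_top_of_nonneg (by linarith) ENNReal.ofReal_ne_top
  refine s₀.2 ⟨max k (C * k), by simp [ENNReal.mul_eq_top, hC], ?_⟩
  filter_upwards [ball_mem_nhds (s₀ : EuclideanSpace ℝ (Fin n)) (half_pos hε)] with z hz
  by_cases hzS : z ∈ singularSet u
  · exact (hk z hzS ((mem_ball.1 hz).trans (half_lt_self hε))).trans (le_max_left _ _)
  obtain ⟨s, hs, hdist⟩ := isClosed_singularSet.exists_infDist_eq_dist hS z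
  have hzs : dist z s ≤ dist z s₀ := hdist ▸ infDist_le_dist_of_mem s₀.2
  have hss₀ : dist s s₀ < ε := by
    have := dist_triangle_left s s₀ z
    have := mem_ball.1 hz
    linarith
  have hne' : z ≠ s := fun h => hzS (h ▸ hs)
  have hd : 0 < ‖z - s‖ := norm_pos_iff.2 (sub_ne_zero.2 hne')
  -- The ball about `z + (z - s) / 4` of radius `3 d / 5`, with `d = dist z s`, contains the
  -- reflecting sphere, of radius `√5 d / 4`, and lies well inside the ball of radius `d` about `z`.
  obtain ⟨M, hM, hbdd⟩ := exists_bound_of_isCompact (u := u)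
    (isCompact_closedBall (z + (1 / 4 : ℝ) • (z - s)) (3 / 5 * ‖z - s‖)) (by
      intro x hx hxS
      have h1 : dist z s ≤ dist z x := hdist ▸ infDist_le_dist_of_mem hxS
      have h2 := dist_triangle_right z x (z + (1 / 4 : ℝ) • (z - s))
      have h3 : dist z (z + (1 / 4 : ℝ) • (z - s)) = 1 / 4 * ‖z - s‖ := by
        rw [dist_self_add_right, norm_smul]
        norm_num
      have h4 := mem_closedBall.1 hx
      rw [dist_eq_norm z s] at h1
      linarith)
  refine (hu.apply_le_of_bddOn_ball hfin hα hαn hp1 hp hne' (by norm_num : (0 : ℝ) < 1 / 4)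
    (ρ := 3 / 5 * ‖z - s‖) ?_ hM (fun x hx => hbdd x (ball_subset_closedBall hx))).trans ?_
  · gcongr
    rw [Real.sqrt_lt' (by norm_num)]
    norm_num
  · exact (mul_le_mul' le_rfl (hk s hs hss₀)).trans (le_max_right _ _)

theorem apply_le_apply (hu : IsPositiveSolution n α p u) (hfin : IsEverywhereFinite u)
    (hα : 0 < α) (hαn : α < n) (hp1 : 1 ≤ p) (hp : p * (n - α) < n + α)
    (y z : EuclideanSpace ℝ (Fin n)) : u z ≤ u y := by
  rcases eq_or_ne z y with rfl | hyz
  · exact le_rfl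
  have hS := hu.singularSet_eq_empty hfin hα hαn hp1 hp
  have hle : ∀ᶠ t : ℝ in atTop, u z ≤ ENNReal.ofReal √((1 + t) / t) ^ (n - α) * u y := by
    filter_upwards [eventually_gt_atTop 0] with t ht
    obtain ⟨M, hM, hbdd⟩ := exists_bound_of_isCompact (u := u)
      (isCompact_closedBall (z + t • (z - y)) (√(t * (1 + t)) * ‖z - y‖ + 1)) (by simp [hS])
    exact hu.apply_le_of_bddOn_ball hfin hα hαn hp1 hp hyz ht (lt_add_one _) hM
      fun x hx => hbdd x (ball_subset_closedBall hx)
  have hlim : Tendsto (fun t : ℝ => (1 + t) / t) atTop (𝓝 1) := by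
    have h : Tendsto (fun t : ℝ => t⁻¹ + 1) atTop (𝓝 (0 + 1)) := tendsto_inv_atTop_zero.add_const 1
    rw [zero_add] at h
    refine h.congr' ?_
    filter_upwards [eventually_ne_atTop 0] with t ht
    field_simp
  have hlim2 : Tendsto (fun t : ℝ => ENNReal.ofReal √((1 + t) / t) ^ (n - α) * u y) atTop
      (𝓝 (ENNReal.ofReal √1 ^ (n - α) * u y)) := by
    refine ENNReal.Tendsto.mul_const ?_ (Or.inr (hfin y))
    exact (ENNReal.continuous_rpow_const.tendsto _).comp
      (ENNReal.tendsto_ofReal ((Real.continuous_sqrt.tendsto 1).comp hlim))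
  rw [Real.sqrt_one, ENNReal.ofReal_one, ENNReal.one_rpow, one_mul] at hlim2
  exact ge_of_tendsto hlim2 hle

/-- A constant is not a solution: since the kernel is homogeneous of degree `α - n > -n`, its integral
`I` over the whole space satisfies `I = 2 ^ α * I` and so is infinite. -/
theorem not_forall_eq (hu : IsPositiveSolution n α p u) (hfin : IsEverywhereFinite u)
    (hα : 0 < α) : ¬ ∀ y, u y = u 0 := by
  intro hconst
  set I := ∫⁻ y : EuclideanSpace ℝ (Fin n), ‖y‖ₑ ^ (α - n)
  have hI : u 0 = I * u 0 ^ p := by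
    rw [← lintegral_mul_const' _ _ (hu.rpow_ne_top hfin 0 p)]
    conv_lhs => rw [hu.eq 0]
    simp [hconst]
  have hI0 : I ≠ 0 := fun h => (hu.pos 0).ne' (by rw [hI, h, zero_mul])
  have hIt : I ≠ ∞ := fun h => hfin 0 (by
    rw [hI, h, ENNReal.top_mul (hu.rpow_ne_zero hfin 0 p)])
  have hscale : I = 2 ^ α * I := by
    have h2 : ENNReal.ofReal 2 = 2 := by simp
    conv_lhs => rw [show I = ∫⁻ y : EuclideanSpace ℝ (Fin n), ‖y‖ₑ ^ (α - n) from rfl,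
      lintegral_comp_smul_eq (R := 2) two_pos]
    simp_rw [enorm_smul, Real.enorm_of_nonneg (zero_le_two (α := ℝ)), h2]
    simp_rw [fun z : EuclideanSpace ℝ (Fin n) => ENNReal.mul_rpow_of_ne_top (x := 2) (y := ‖z‖ₑ)
      (by simp) (by finiteness) (α - n)]
    rw [lintegral_const_mul' _ _ (ENNReal.rpow_ne_top_of_ne_zero (by simp) (by simp)), ← mul_assoc,
      ← ENNReal.rpow_add _ _ (by simp) (by simp), add_sub_cancel]
  have h1 : (1 : ℝ≥0∞) < 2 ^ α := ENNReal.one_lt_rpow (by simp) hα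
  have h3 : 1 * I < 2 ^ α * I := ENNReal.mul_lt_mul_left hI0 hIt h1
  rw [one_mul, ← hscale] at h3
  exact h3.false

end IsPositiveSolution

end Singular

theorem theorem2p1 (n : ℕ) (α p : ℝ) (hα : 0 < α) (hαn : α < n)
    (hp : p < (n + α) / (n - α)) :
    ¬ ∃ u : EuclideanSpace ℝ (Fin n) → ℝ≥0∞, IsPositiveSolution n α p u ∧ IsEverywhereFinite u := by
  rintro ⟨u, hu, hfin⟩
  rcases lt_or_ge p 1 with hp1 | hp1
  · exact hu.not_isEverywhereFinite_of_lt_one hα hαn hp1 hfin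
  · have hp' : p * (n - α) < n + α := (lt_div_iff₀ (by linarith)).1 hp
    exact hu.not_forall_eq hfin hα fun y => le_antisymm
      (hu.apply_le_apply hfin hα hαn hp1 hp' 0 y) (hu.apply_le_apply hfin hα hαn hp1 hp' y 0)
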